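/- Let $K$ be an algebraically closed field, $X$ an algebraic group over $K$ (a group object in $K$-schemes that is reduced and of finite type over $K$; not assumed connected, affine or commutative), and $A = X(K)$ with neutral element $e$. Let $G$ be a group. For finite $F \subset G$, the set $A^F = X^F(K)$ carries the Zariski topology of the fibered power $X^F$ over $K$. Let $\tau \in CA_{algr}(G,X,K)$, i.e. $\tau \colon A^G \to A^G$ is a map for which there are a finite set $M \subset G$ and a homomorphism of algebraic groups $f \colon X^M \to X$ such that $\tau(c)(g) = f\big((g^{-1}c)|_M\big)$ for all $c \in A^G$ and $g \in G$, where $(gc)(h) = c(g^{-1}h)$. For finite $\Omega \subset G$ and $D \subset A^\Omega$, put $D_e = D \times \{e\}^{G \setminus \Omega} \subset A^G$. Suppose that $\tau$ is $(\bullet)$-pre-injective: there do not exist a finite subset $\Omega \subset G$ and a Zariski closed proper subset $H \subsetneq A^\Omega$ such that $\tau((A^\Omega)_e) = \tau(H_e)$. Then $\tau$ is $(\bullet\bullet)$-pre-injective: for every finite subset $\Omega \subset G$, $$\dim \tau((A^\Omega)_e) = \dim A^\Omega .$$ Here $\dim$ is the Krull dimension for the Zariski topology, where $A^G$ is given the coarsest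 topology making the restriction maps $A^G \to A^F$ continuous for all finite $F \subset G$, and subsets carry the subspace topology. (Equivalently, $\dim \tau((A^\Omega)_e)$ is the dimension of $\tau((A^\Omega)_e)$ as a subset of $A^F$, for any finite $F \subset G$ with $\tau((A^\Omega)_e) \subset (A^F)_e$.) -/

import Mathlib

open scoped Topology
open CategoryTheory MonoidalCategory Limits AlgebraicGeometry

universe u v

noncomputable section

namespace AlgCA

/-- Group schemes over the field `K`; morphisms are homomorphisms of group schemes over `K`. -/
abbrev GroupScheme (K : Type u) [Field K] := Grp (Over (Spec (CommRingCat.of K)))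

/-- An algebraic group over `K`: a group scheme over `K` that is reduced and of finite type. -/
structure IsAlgebraicGroup {K : Type u} [Field K] (X : GroupScheme K) : Prop where
  reduced : IsReduced X.X.left
  locallyOfFiniteType : LocallyOfFiniteType X.X.hom
  quasiCompact : QuasiCompact X.X.hom

variable {K : Type u} [Field K]

/-- The set `X(K)` of `K`-points of `X`, i.e. of sections of `X → Spec K` (here `𝟙_ _` is
`Spec K`, as a scheme over itself). -/
abbrev Points (X : GroupScheme K) := 𝟙_ (Over (Spec (CommRingCat.of K))) ⟶ X.X

/-- The neutral element `e` of `X(K)`. -/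
def neutral (X : GroupScheme K) : Points X := MonObj.one

/-- The map `X(K) → Y(K)` induced by a homomorphism `f : X → Y`. -/
def mapPoints {X Y : GroupScheme K} (f : X ⟶ Y) (p : Points X) : Points Y := p ≫ f.hom.hom

/-- The fibered product `X^ι` over `K` of copies of `X`, with its product group structure. -/
abbrev power (X : GroupScheme K) (ι : Type v) [Finite ι] : GroupScheme K := ∏ᶜ fun _ : ι ↦ X

/-- The `K`-morphism `T → X^ι` with given coordinates `T → X`. -/
def powerLift {X : GroupScheme K} {ι : Type v} [Finite ι] {T : Over (Spec (CommRingCat.of K))}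
    (c : ι → (T ⟶ X.X)) : T ⟶ (power X ι).X :=
  Fan.IsLimit.lift
    (isLimitOfHasProductOfPreservesLimit (Grp.forget (Over (Spec (CommRingCat.of K))))
      (fun _ : ι ↦ X)) c

/-- The `i`-th projection `X^ι → X`. -/
def powerProj (X : GroupScheme K) {ι : Type v} [Finite ι] (i : ι) : (power X ι).X ⟶ X.X :=
  (Pi.π (fun _ : ι ↦ X) i).hom.hom

theorem powerLift_proj {X : GroupScheme K} {ι : Type v} [Finite ι]
    {T : Over (Spec (CommRingCat.of K))} (c : ι → (T ⟶ X.X)) (i : ι) :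
    powerLift c ≫ powerProj X i = c i :=
  Fan.IsLimit.fac
    (isLimitOfHasProductOfPreservesLimit (Grp.forget (Over (Spec (CommRingCat.of K))))
      (fun _ : ι ↦ X)) c i

theorem power_hom_ext {X : GroupScheme K} {ι : Type v} [Finite ι]
    {T : Over (Spec (CommRingCat.of K))} {f g : T ⟶ (power X ι).X}
    (h : ∀ i, f ≫ powerProj X i = g ≫ powerProj X i) : f = g :=
  Fan.IsLimit.hom_ext
    (isLimitOfHasProductOfPreservesLimit (Grp.forget (Over (Spec (CommRingCat.of K))))
      (fun _ : ι ↦ X)) f g h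

/-- The identification `X^ι(K) = X(K)^ι`. -/
def pointsPower (X : GroupScheme K) (ι : Type v) [Finite ι] :
    Points (power X ι) ≃ (ι → Points X) where
  toFun p i := p ≫ powerProj X i
  invFun c := powerLift c
  left_inv _ := power_hom_ext fun i ↦ powerLift_proj _ i
  right_inv _ := funext fun i ↦ powerLift_proj _ i

/-- The point of the underlying space of `X` given by a `K`-point. -/
def Points.toPoint {X : GroupScheme K} (p : Points X) : X.X.left :=
  p.left (IsLocalRing.closedPoint K)

/-- The Zariski topology on `X(K)`: the subspace topology from the scheme `X`. -/
@[reducible] def zariski (X : GroupScheme K) : TopologicalSpace (Points X) :=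
  TopologicalSpace.induced Points.toPoint inferInstance

/-- The Zariski topology on `X(K)^ι = X^ι(K)` for finite `ι` (not the product topology). -/
@[reducible] def zariskiPower (X : GroupScheme K) (ι : Type v) [Finite ι] : TopologicalSpace (ι → Points X) :=
  TopologicalSpace.induced (pointsPower X ι).symm (zariski (power X ι))

/-- The Krull dimension of a subset `S` of a space with topology `t`, for the subspace topology. -/
def krullDimOf {α : Type*} (t : TopologicalSpace α) (S : Set α) : WithBot ℕ∞ :=
  @topologicalKrullDim S (t.induced Subtype.val)

variable {G : Type v}

/-- The restriction `c|_Ω` of a configuration. -/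
def restrict {A : Type*} (Ω : Finset G) (c : G → A) : Ω → A := fun g ↦ c g

/-- The Zariski topology on `A^G`, `A = X(K)`: the coarsest topology for which the restriction
maps `A^G → A^F`, `F ⊆ G` finite, are continuous. On subsets of `A^F × {e}^(G ∖ F)` it is the
Zariski topology of `A^F`, see `krullDimOf_zariskiConfig`. -/
@[reducible] def zariskiConfig (G : Type v) (X : GroupScheme K) : TopologicalSpace (G → Points X) :=
  ⨅ F : Finset G, TopologicalSpace.induced (restrict F) (zariskiPower X F)

/-- `D_e = D × {e}^(G ∖ Ω)` for `D ⊆ A^Ω`, `A = X(K)`. -/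
def extendByNeutral {X : GroupScheme K} {Ω : Finset G} (D : Set (Ω → Points X)) :
    Set (G → Points X) :=
  {c | restrict Ω c ∈ D ∧ ∀ g ∉ Ω, c g = neutral X}

theorem continuous_points {X Y : GroupScheme K} (h : X.X ⟶ Y.X) :
    @Continuous _ _ (zariski X) (zariski Y) (fun p : Points X ↦ (p ≫ h : Points Y)) := by
  let _ := zariski X
  let _ := zariski Y
  refine continuous_induced_rng.2 ?_
  have : Points.toPoint ∘ (fun p : Points X ↦ (p ≫ h : Points Y)) =
      h.left ∘ (Points.toPoint (X := X)) := by
    funext p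
    simp only [Points.toPoint, Function.comp_apply, Over.comp_left]
    exact Scheme.Hom.comp_apply _ _ _
  rw [this]
  exact h.left.continuous.comp continuous_induced_dom

open Classical in
theorem continuous_extend {X : GroupScheme K} (F F' : Finset G) :
    @Continuous _ _ (zariskiPower X F) (zariskiPower X F')
      (fun a i ↦ if h : i.1 ∈ F then a ⟨i.1, h⟩ else neutral X) := by
  let _ := zariskiPower X F
  let _ := zariskiPower X F'
  let _ := zariski (power X F)
  let _ := zariski (power X F')
  refine continuous_induced_rng.2 ?_
  let m : (power X F).X ⟶ (power X F').X := powerLift fun i : F' ↦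
    if h : i.1 ∈ F then powerProj X (⟨i.1, h⟩ : F)
    else CartesianMonoidalCategory.toUnit _ ≫ neutral X
  have key : (pointsPower X F').symm ∘
      (fun (a : F → Points X) (i : F') ↦ if h : i.1 ∈ F then a ⟨i.1, h⟩ else neutral X) =
      (fun p : Points (power X F) ↦ (p ≫ m : Points (power X F'))) ∘ (pointsPower X F).symm := by
    funext a
    rw [Function.comp_apply, Equiv.symm_apply_eq]
    funext i
    change _ = (_ ≫ m) ≫ powerProj X i
    rw [Category.assoc, powerLift_proj]
    by_cases h : i.1 ∈ F
    · simp only [h, dif_pos]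
      exact (congrFun ((pointsPower X F).apply_symm_apply a) ⟨i.1, h⟩).symm
    · simp only [h, dif_neg, not_false_eq_true]
      rw [← Category.assoc, CartesianMonoidalCategory.toUnit_unique
        (_ ≫ CartesianMonoidalCategory.toUnit _) (𝟙 _), Category.id_comp]
  rw [key]
  exact (continuous_points m).comp continuous_induced_dom

/-- For a set `S` of configurations that are neutral outside the finite set `F`, the dimension of
`S` is the dimension of `S` as a subset of `A^F`. -/
theorem krullDimOf_zariskiConfig {X : GroupScheme K} (F : Finset G) (S : Set (G → Points X))
    (hS : S ⊆ extendByNeutral (Ω := F) Set.univ) :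
    krullDimOf (zariskiConfig G X) S = krullDimOf (zariskiPower X F) (restrict F '' S) := by
  let tS : TopologicalSpace S := (zariskiConfig G X).induced Subtype.val
  let tF := zariskiPower X F
  let φ : S → restrict F '' S := fun c ↦ ⟨restrict F c.1, c.1, c.2, rfl⟩
  have hind : tS = (tF.induced Subtype.val).induced φ := by
    classical
    let v : S → G → Points X := Subtype.val
    let w : restrict F '' S → F → Points X := Subtype.val
    have hF : (tF.induced w).induced φ = (tF.induced (restrict F)).induced v := by
      have h1 : (tF.induced w).induced φ = tF.induced (w ∘ φ) := induced_compose
      have h2 : (tF.induced (restrict F)).induced v = tF.induced (restrict F ∘ v) :=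
        induced_compose
      exact h1.trans h2.symm
    have hle (F' : Finset G) : (tF.induced w).induced φ ≤
        ((zariskiPower X F').induced (restrict F')).induced v := by
      have hv : restrict F' ∘ v =
          (fun a i ↦ if h : i.1 ∈ F then a ⟨i.1, h⟩ else neutral X) ∘ (w ∘ φ) := by
        funext c i
        by_cases h : i.1 ∈ F
        · simp [h, restrict, φ, v, w]
        · simpa [h, restrict, φ, v, w] using (hS c.2).2 i.1 h
      generalize ht : zariskiPower X F' = t
      have hc := continuous_iff_le_induced.1 (continuous_extend (X := X) F F')
      rw [ht] at hc
      have h1 : (tF.induced w).induced φ = tF.induced (w ∘ φ) := induced_compose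
      have h2 : (t.induced (restrict F')).induced v = t.induced (restrict F' ∘ v) :=
        induced_compose
      have h3 := (induced_mono (g := w ∘ φ) hc).trans_eq induced_compose
      exact h1.trans_le (h3.trans_eq ((congrArg (fun q ↦ TopologicalSpace.induced q t) hv).symm.trans h2.symm))
    have hS' : tS = ⨅ F' : Finset G,
        ((zariskiPower X F').induced (restrict F')).induced v := induced_iInf
    change tS = (tF.induced w).induced φ
    rw [hS']
    exact le_antisymm ((iInf_le _ F).trans hF.ge) (le_iInf hle)
  have hinj : Function.Injective φ := by
    intro c d h
    refine Subtype.ext (funext fun g ↦ ?_)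
    by_cases hg : g ∈ F
    · exact congrFun (congrArg Subtype.val h) ⟨g, hg⟩
    · rw [(hS c.2).2 g hg, (hS d.2).2 g hg]
  have hsurj : Function.Surjective φ := by
    rintro ⟨_, c, hc, rfl⟩
    exact ⟨⟨c, hc⟩, rfl⟩
  have hemb : Topology.IsEmbedding φ := ⟨⟨hind⟩, hinj⟩
  exact IsHomeomorph.topologicalKrullDim_eq φ
    (isHomeomorph_iff_isEmbedding_surjective.2 ⟨hemb, hsurj⟩)

section CellularAutomata

variable [Group G]

/-- The Bernoulli shift `(g c)(h) = c(g⁻¹ h)`. -/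
def shift {A : Type*} (g : G) (c : G → A) : G → A := fun h ↦ c (g⁻¹ * h)

/-- `τ : A^G → A^G` is the cellular automaton with memory set `M` and local defining map `μ`. -/
def HasLocalMap {A : Type*} (τ : (G → A) → (G → A)) (M : Finset G) (μ : (M → A) → A) : Prop :=
  ∀ (c : G → A) (g : G), τ c g = μ (restrict M (shift g⁻¹ c))

/-- The set `CA_algr(G, X, K)` of algebraic group cellular automata `A^G → A^G`, `A = X(K)`. -/
def CAalgr (G : Type v) [Group G] (X : GroupScheme K) :
    Set ((G → Points X) → (G → Points X)) :=
  {τ | ∃ (M : Finset G) (f : power X M ⟶ X),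
    HasLocalMap τ M fun a ↦ mapPoints f ((pointsPower X M).symm a)}

/-- `(•)`-pre-injectivity. -/
def OneDotPreInjective {X : GroupScheme K} (τ : (G → Points X) → (G → Points X)) : Prop :=
  ¬ ∃ (Ω : Finset G) (H : Set (Ω → Points X)), IsClosed[zariskiPower X Ω] H ∧ H ⊂ Set.univ ∧
    τ '' extendByNeutral (Ω := Ω) Set.univ = τ '' extendByNeutral H

/-- `(••)`-pre-injectivity. -/
def TwoDotPreInjective {X : GroupScheme K} (τ : (G → Points X) → (G → Points X)) : Prop :=
  ∀ Ω : Finset G, krullDimOf (zariskiConfig G X) (τ '' extendByNeutral (Ω := Ω) Set.univ) =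
    krullDimOf (zariskiPower X Ω) Set.univ

end CellularAutomata

end AlgCA

end

/-! On configurations that are `e` outside `Ω`, `τ` is a homomorphism of algebraic groups `φ : X^Ω →
X^F` (`inducedHom`). It thus suffices that a homomorphism whose full image is not the image of any
proper closed subset preserves dimension (`krullDim_range_mapPoints`).

The theorem on the dimension of fibres is replaced by a slice. Over the image `P` of the generic
point of an irreducible affine open piece of the source, choose a closed point `q` of the fibre.
Then `B ⧸ q` is algebraic over `A ⧸ P`, and inverting one element makes it integral. This gives a
nonempty open `U` and a closed `C` (the closure of `q`) with `φ(C ∩ U) = φ(U)` locally closed; if `U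
⊆ C`, the integral extension gives `dim U = dim φ(U)` (`exists_isClosed_image_eq`).

Homogeneity does the rest (`topologicalKrullDim_range_eq`). Finitely many translates of `U` cover
the group. If `U ⊄ C`, the closures of the corresponding translates of `C ∩ U` form a proper closed
set with full image, which is excluded. So `U ⊆ C`, and translation carries `dim U = dim φ(U)` over
to the whole source and the whole image.

The argument mixes schemes and `K`-points; `IsVeryDense` passes between them. -/

namespace AlgCA

open Set TopologicalSpace Topology

/-! ### Very dense maps, Krull dimension and nowhere dense sets -/

section Topology

variable {S Z : Type*} [TopologicalSpace S] [TopologicalSpace Z]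

/-- `f` is inducing and its range meets every nonempty locally closed set. -/
structure IsVeryDense (f : S → Z) : Prop where
  isInducing : IsInducing f
  exists_mem : ∀ ⦃W : Set Z⦄, IsLocallyClosed W → W.Nonempty → ∃ s, f s ∈ W

theorem IsVeryDense.isIrreducible_preimage {f : S → Z} (hf : IsVeryDense f) {W : Set Z}
    (hW : IsLocallyClosed W) (hi : IsIrreducible W) : IsIrreducible (f ⁻¹' W) := by
  refine ⟨hf.exists_mem hW hi.nonempty, ?_⟩
  intro V' W' hV' hW' hCV hCW
  obtain ⟨V, hV, rfl⟩ := hf.isInducing.isOpen_iff.1 hV'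
  obtain ⟨V₂, hV₂, rfl⟩ := hf.isInducing.isOpen_iff.1 hW'
  exact hf.exists_mem (hW.inter (hV.inter hV₂).isLocallyClosed)
    (hi.isPreirreducible V V₂ hV hV₂ (hCV.imp' f fun _ ↦ id) (hCW.imp' f fun _ ↦ id))

/-- Preimage is strictly monotone on irreducible closed sets: for `C < D` the nonempty locally
closed set `D \ C` meets the range of `f`. -/
theorem IsVeryDense.topologicalKrullDim_eq {f : S → Z} (hf : IsVeryDense f) :
    topologicalKrullDim S = topologicalKrullDim Z := by
  refine le_antisymm hf.isInducing.topologicalKrullDim_le ?_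
  let r (C : IrreducibleCloseds Z) : IrreducibleCloseds S :=
    ⟨f ⁻¹' C, hf.isIrreducible_preimage C.isClosed.isLocallyClosed C.isIrreducible,
      C.isClosed.preimage hf.isInducing.continuous⟩
  refine Order.krullDim_le_of_strictMono r fun C D hCD ↦ lt_of_le_not_ge
    (preimage_mono (f := f) hCD.le) fun hDC ↦ ?_
  obtain ⟨z, hzD, hzC⟩ := Set.not_subset.1 (show ¬ (D : Set Z) ⊆ C from hCD.not_ge)
  obtain ⟨s, hs⟩ := hf.exists_mem
    (C.isClosed.isOpen_compl.isLocallyClosed.inter D.isClosed.isLocallyClosed) ⟨z, hzC, hzD⟩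
  exact hs.1 (hDC hs.2)

theorem IsVeryDense.topologicalKrullDim_preimage_eq {f : S → Z} (hf : IsVeryDense f) {W : Set Z}
    (hW : IsLocallyClosed W) : topologicalKrullDim (f ⁻¹' W) = topologicalKrullDim W := by
  refine IsVeryDense.topologicalKrullDim_eq (f := W.restrictPreimage f) ⟨?_, fun V hV hne ↦ ?_⟩
  · exact hf.isInducing.restrictPreimage W
  · obtain ⟨U, C, hU, hC, rfl⟩ := hV
    obtain ⟨U', hU', rfl⟩ := isOpen_induced_iff.1 hU
    obtain ⟨C', hC', rfl⟩ := isClosed_induced_iff.1 hC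
    obtain ⟨z, hz⟩ := hne
    obtain ⟨s, hs, hs'⟩ := hf.exists_mem (hW.inter (hU'.isLocallyClosed.inter hC'.isLocallyClosed))
      ⟨z.1, z.2, hz.1, hz.2⟩
    exact ⟨⟨s, hs⟩, hs'⟩

/-- The dimension of a space is bounded by that of its open sets. -/
theorem topologicalKrullDim_le_of_forall_exists_isOpen {d : WithBot ℕ∞}
    (h : ∀ z : Z, ∃ U : Set Z, IsOpen U ∧ z ∈ U ∧ topologicalKrullDim U ≤ d) :
    topologicalKrullDim Z ≤ d := by
  refine iSup_le fun p ↦ ?_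
  obtain ⟨z, hz⟩ := p.head.isIrreducible.nonempty
  obtain ⟨U, hU, hzU, hd⟩ := h z
  refine le_trans ?_ hd
  let e := IrreducibleCloseds.orderIsoOfIsOpenEmbedding ((↑) : U → Z) hU.isOpenEmbedding_subtypeVal
  -- `z` lies in the smallest member of the chain, so `U` meets every member.
  let q : LTSeries {V : IrreducibleCloseds Z | (((↑) : U → Z) ⁻¹' (V : Set Z)).Nonempty} :=
    { length := p.length
      toFun := fun i ↦ ⟨p i, ⟨z, hzU⟩, (LTSeries.head_le p i : p.head ≤ p i) hz⟩
      step := p.step }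
  exact Order.LTSeries.length_le_krullDim (q.map e.symm e.symm.strictMono)

theorem interior_biUnion_eq_empty {ι : Type*} (s : Finset ι) (D : ι → Set Z)
    (hc : ∀ i, IsClosed (D i)) (hi : ∀ i, interior (D i) = ∅) :
    interior (⋃ i ∈ s, D i) = ∅ := by
  classical
  induction s using Finset.induction_on with
  | empty => simp
  | insert i s _ ih =>
    rw [Finset.set_biUnion_insert, interior_union_isClosed_of_interior_empty (hc i) ih, hi]

/-- A locally closed set is open in its closure, so an open set inside the closure meets it in an
open set. -/
theorem interior_closure_eq_empty {W : Set Z} (hW : IsLocallyClosed W) (hi : interior W = ∅) :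
    interior (closure W) = ∅ := by
  obtain ⟨U, C, hU, hC, rfl⟩ := hW
  by_contra! hne
  obtain ⟨z, hz⟩ := hne
  obtain ⟨w, hw, hwU, hwC⟩ := mem_closure_iff.1 (interior_subset hz) _ isOpen_interior hz
  have : interior (closure (U ∩ C)) ∩ U ⊆ interior (U ∩ C) :=
    interior_maximal (fun x hx ↦ ⟨hx.2, hC.closure_subset_iff.2 inter_subset_right
      (interior_subset hx.1)⟩) (isOpen_interior.inter hU)
  rw [hi] at this
  exact this ⟨hw, hwU⟩

theorem exists_interior_nonempty [Nonempty Z] {ι : Type*} (s : Finset ι) (W : ι → Set Z)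
    (hW : ∀ i, IsLocallyClosed (W i)) (h : ⋃ i ∈ s, W i = univ) :
    ∃ i, (interior (W i)).Nonempty := by
  by_contra! hne
  have := interior_biUnion_eq_empty s (fun i ↦ closure (W i)) (fun _ ↦ isClosed_closure)
    fun i ↦ interior_closure_eq_empty (hW i) (hne i)
  have h' : ⋃ i ∈ s, closure (W i) = univ :=
    univ_subset_iff.1 (h ▸ iUnion₂_mono fun i _ ↦ subset_closure)
  rw [h', interior_univ] at this
  exact univ_nonempty.ne_empty this

end Topology

/-! ### Equivariant maps from a homogeneous space -/

section Homogeneous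

variable {P Q : Type*} [TopologicalSpace P] [TopologicalSpace Q]

/-- A map of spaces on which compatible homeomorphisms act transitively on the source preserves
the dimension if no proper closed set has the same image as the whole source. -/
theorem topologicalKrullDim_range_eq [CompactSpace P] {φ : P → Q}
    (hom : ∀ x y : P, ∃ (α : P ≃ₜ P) (β : Q ≃ₜ Q), α x = y ∧ ∀ p, φ (α p) = β (φ p))
    {U C : Set P} (hU : IsOpen U) (hUi : IsIrreducible U)
    (hCU : φ '' (C ∩ U) = φ '' U) (hlc : IsLocallyClosed (φ '' U)) (hC : IsClosed C)
    (hdim : U ⊆ C → topologicalKrullDim U = topologicalKrullDim (φ '' U))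
    (h : ∀ H : Set P, IsClosed H → φ '' H = range φ → H = univ) :
    topologicalKrullDim (range φ) = topologicalKrullDim P := by
  obtain ⟨x, hx⟩ := hUi.nonempty
  have : Nonempty P := ⟨x⟩
  choose α β hα hαβ using hom x
  have himg (y : P) (D : Set P) : φ '' (α y '' D) = β y '' (φ '' D) := by
    simp only [image_image, hαβ]
  obtain ⟨s, hs⟩ := isCompact_univ.elim_finite_subcover (fun y ↦ α y '' U)
    (fun y ↦ (α y).isOpenMap U hU) fun y _ ↦ mem_iUnion.2 ⟨y, x, hx, hα y⟩
  have hrange : ⋃ y ∈ s, β y '' (φ '' U) = range φ := by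
    simp only [← himg, ← image_iUnion₂, univ_subset_iff.1 hs, image_univ]
  -- Otherwise `C ∩ U` is nowhere dense, since `U` is irreducible. The finite union of the
  -- translates of its closure is then closed with empty interior, yet its image is all of `range
  -- φ`.
  have hUC : U ⊆ C := by
    by_contra hne
    obtain ⟨u, huU, huC⟩ := Set.not_subset.1 hne
    have hD : interior (closure (C ∩ U)) = ∅ := by
      by_contra! hD
      obtain ⟨z, hz⟩ := hD
      obtain ⟨w, hw, -, hwU⟩ := mem_closure_iff.1 (interior_subset hz) _ isOpen_interior hz
      obtain ⟨v, -, hv, hvC⟩ := hUi.isPreirreducible _ _ isOpen_interior hC.isOpen_compl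
        ⟨w, hwU, hw⟩ ⟨u, huU, huC⟩
      exact hvC (hC.closure_subset_iff.2 inter_subset_left (interior_subset hv))
    have hE (y : P) : IsClosed (α y '' closure (C ∩ U)) := (α y).isClosedMap _ isClosed_closure
    have hemp := interior_biUnion_eq_empty s (fun y ↦ α y '' closure (C ∩ U)) hE fun y ↦ by
      rw [← (α y).image_interior, hD, image_empty]
    rw [h _ (isClosed_biUnion_finset fun y _ ↦ hE y), interior_univ] at hemp
    · exact univ_nonempty.ne_empty hemp
    · refine (image_subset_range _ _).antisymm ?_
      rw [← hrange, image_iUnion₂]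
      refine iUnion₂_mono fun y _ ↦ ?_
      rw [himg, ← hCU]
      exact image_mono (image_mono subset_closure)
  have hβ (y : P) : β y '' range φ = range φ := by
    rw [← image_univ, ← himg, image_univ_of_surjective (α y).surjective]
  have hP : topologicalKrullDim P = topologicalKrullDim U := by
    refine le_antisymm ?_ (topologicalKrullDim_subspace_le P U)
    refine topologicalKrullDim_le_of_forall_exists_isOpen fun y ↦
      ⟨α y '' U, (α y).isOpenMap U hU, ⟨x, hx, hα y⟩, ?_⟩
    exact (((α y).image U).isHomeomorph.topologicalKrullDim_eq).ge
  rw [hP, hdim hUC]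
  refine le_antisymm ?_ ?_
  swap
  · exact (IsEmbedding.inclusion (image_subset_range φ U)).isInducing.topologicalKrullDim_le
  have hlc' (y : P) : IsLocallyClosed (((↑) : range φ → Q) ⁻¹' (β y '' (φ '' U))) := by
    refine IsLocallyClosed.preimage ?_ continuous_subtype_val
    rw [(β y).image_eq_preimage_symm]
    exact hlc.preimage (β y).symm.continuous
  -- Finitely many locally closed translates of `φ '' U` cover `range φ`, so one of them has
  -- interior in `range φ`.
  obtain ⟨y, ⟨q, p, rfl⟩, hq⟩ := exists_interior_nonempty s _ hlc' (by
    rw [← preimage_iUnion₂, hrange, Subtype.coe_preimage_self])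
  obtain ⟨O, hO, hOeq⟩ := isOpen_induced_iff.1 (isOpen_interior (s :=
    (((↑) : range φ → Q) ⁻¹' (β y '' (φ '' U)))))
  have hOsub (p : P) (hp : φ p ∈ O) : (β y).symm (φ p) ∈ φ '' U := by
    have : (⟨φ p, p, rfl⟩ : range φ) ∈ interior (((↑) : range φ → Q) ⁻¹' (β y '' (φ '' U))) :=
      hOeq ▸ hp
    obtain ⟨q, hq, hqp⟩ := interior_subset this
    change β y q = φ p at hqp
    rwa [← hqp, Homeomorph.symm_apply_apply]
  refine topologicalKrullDim_le_of_forall_exists_isOpen fun ⟨_, p', rfl⟩ ↦ ?_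
  -- Translation moves this interior to any point of the range, so every point has an open
  -- neighbourhood that embeds in `φ '' U`.
  obtain ⟨α', β', hα', hαβ'⟩ := hom p p'
  have hsymm (p : P) : β'.symm (φ p) = φ (α'.symm p) := by
    rw [Homeomorph.symm_apply_eq, ← hαβ', Homeomorph.apply_symm_apply]
  refine ⟨(fun t : range φ ↦ β'.symm t) ⁻¹' O,
    hO.preimage (β'.symm.continuous.comp continuous_subtype_val), ?_, ?_⟩
  · change β'.symm (φ p') ∈ O
    rw [hsymm, ← hα', Homeomorph.symm_apply_apply]
    exact (hOeq.symm ▸ hq : (⟨φ p, p, rfl⟩ : range φ) ∈ ((↑) : range φ → Q) ⁻¹' O)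
  · let γ (t : (fun t : range φ ↦ β'.symm t) ⁻¹' O) : φ '' U :=
      ⟨(β y).symm (β'.symm t), by
        obtain ⟨⟨_, p, rfl⟩, ht⟩ := t
        change β'.symm (φ p) ∈ O at ht
        rw [hsymm] at ht
        change (β y).symm (β'.symm (φ p)) ∈ _
        rw [hsymm]
        exact hOsub _ ht⟩
    have hγ : IsInducing γ := by
      rw [← IsInducing.subtypeVal.of_comp_iff]
      exact (((β y).symm.isInducing.comp β'.symm.isInducing).comp IsInducing.subtypeVal).comp
        IsInducing.subtypeVal
    exact hγ.topologicalKrullDim_le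

end Homogeneous

/-! ### Integral and algebraic extensions -/

section Algebra

variable (R S : Type*) [CommRing R] [CommRing S] [Algebra R S]

theorem ringKrullDim_le_of_isIntegral [Algebra.IsIntegral R S] :
    ringKrullDim S ≤ ringKrullDim R :=
  Order.krullDim_le_of_strictMono (PrimeSpectrum.comap (algebraMap R S)) fun _ _ h ↦
    Ideal.IsIntegral.comap_lt_comap h

theorem comap_surjective_of_isIntegral [Algebra.IsIntegral R S]
    (h : Function.Injective (algebraMap R S)) :
    Function.Surjective (PrimeSpectrum.comap (algebraMap R S)) := fun P ↦ by
  obtain ⟨Q, -, hQ, hQP⟩ := Ideal.exists_ideal_over_prime_of_isIntegral P.asIdeal (⊥ : Ideal S)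
    (by rw [← RingHom.ker_eq_comap_bot, (RingHom.injective_iff_ker_eq_bot _).1 h]; exact bot_le)
  exact ⟨⟨Q, hQ⟩, PrimeSpectrum.ext hQP⟩

/-- Lying over and going up lift every chain of primes; incomparability gives the other inequality.
-/
theorem ringKrullDim_eq_of_isIntegral [Algebra.IsIntegral R S]
    (h : Function.Injective (algebraMap R S)) : ringKrullDim S = ringKrullDim R := by
  refine le_antisymm (ringKrullDim_le_of_isIntegral R S) (iSup_le fun l ↦ ?_)
  obtain ⟨P, hP⟩ := comap_surjective_of_isIntegral R S h l.head
  have : P.asIdeal.LiesOver l.head.asIdeal := ⟨by rw [← hP]; rfl⟩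
  obtain ⟨L, hL, -⟩ := Ideal.exists_ltSeries_of_hasGoingUp l P.asIdeal
  rw [← hL]
  exact Order.LTSeries.length_le_krullDim L

/-- `a` is a common denominator for finitely many generators. Products of generators accumulate
powers of it, so `n` depends on `x`. -/
theorem exists_isIntegral_pow_smul [IsDomain R] [Algebra.FiniteType R S]
    [Algebra.IsAlgebraic R S] :
    ∃ a : R, a ≠ 0 ∧ ∀ x : S, ∃ n : ℕ, IsIntegral R (a ^ n • x) := by
  classical
  obtain ⟨t, ht⟩ := (inferInstance : Algebra.FiniteType R S).out
  obtain ⟨a, ha, hat⟩ := Algebra.IsAlgebraic.exists_integral_multiples R t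
  refine ⟨a, ha, fun x ↦ ?_⟩
  have hx : x ∈ Algebra.adjoin R (t : Set S) := ht ▸ Algebra.mem_top
  induction hx using Algebra.adjoin_induction with
  | mem x hx => exact ⟨1, by simpa using hat x hx⟩
  | algebraMap r => exact ⟨0, by simpa using isIntegral_algebraMap⟩
  | add x y _ _ hx hy =>
    obtain ⟨m, hm⟩ := hx
    obtain ⟨n, hn⟩ := hy
    refine ⟨n + m, ?_⟩
    rw [smul_add, pow_add, mul_smul, mul_comm, mul_smul]
    exact (hm.smul _).add (hn.smul _)
  | mul x y _ _ hx hy =>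
    obtain ⟨m, hm⟩ := hx
    obtain ⟨n, hn⟩ := hy
    refine ⟨m + n, ?_⟩
    rw [pow_add, ← smul_mul_smul_comm]
    exact hm.mul hn

variable {R S}

theorem isIntegral_away {a : R} (ha : ∀ x : S, ∃ n : ℕ, IsIntegral R (a ^ n • x))
    (R' S' : Type*) [CommRing R'] [CommRing S'] [Algebra R R'] [Algebra S S'] [Algebra R S']
    [Algebra R' S'] [IsScalarTower R R' S'] [IsScalarTower R S S'] [IsLocalization.Away a R']
    [IsLocalization.Away (algebraMap R S a) S'] : Algebra.IsIntegral R' S' := by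
  have hmul (n : ℕ) (z : S') : IsLocalization.Away.invSelf (S := R') a ^ n • a ^ n • z = z := by
    rw [← algebraMap_smul R' (a ^ n) z, smul_smul, map_pow, ← mul_pow,
      mul_comm (IsLocalization.Away.invSelf a), IsLocalization.Away.mul_invSelf, one_pow, one_smul]
  refine ⟨fun z ↦ ?_⟩
  obtain ⟨n, x, hz⟩ := IsLocalization.Away.surj (algebraMap R S a) z
  obtain ⟨m, hm⟩ := ha x
  have h1 : _root_.IsIntegral R' (algebraMap S S' (a ^ m • x)) :=
    (hm.map (IsScalarTower.toAlgHom R S S')).tower_top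
  have h2 : a ^ n • z = algebraMap S S' x := by
    rw [← hz, Algebra.smul_def, mul_comm, map_pow, ← IsScalarTower.algebraMap_apply R S S']
  have h3 : algebraMap S S' (a ^ m • x) = a ^ m • algebraMap S S' x :=
    map_smul (IsScalarTower.toAlgHom R S S') _ _
  rw [← hmul n z, h2, ← hmul m (algebraMap S S' x), ← h3]
  exact (h1.smul _).smul _

end Algebra

/-! ### The slice for affine schemes -/

section Affine

variable {A B : Type*} [CommRing A] [CommRing B] [Algebra A B]

/-- `B ⧸ ker f` embeds in `L`, which is algebraic over the fraction field `κ` of `A ⧸ P`. -/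
theorem isAlgebraic_quotient_ker (P : Ideal A) [P.IsPrime] (κ L : Type*) [Field κ] [Field L]
    [Algebra (A ⧸ P) κ] [IsFractionRing (A ⧸ P) κ] [Algebra κ L] (f : B →+* L)
    (hκ : Algebra.IsAlgebraic κ L) [(RingHom.ker f).LiesOver P]
    (h : ∀ a, f (algebraMap A B a) = algebraMap κ L (algebraMap (A ⧸ P) κ (Ideal.Quotient.mk P a))) :
    Algebra.IsAlgebraic (A ⧸ P) (B ⧸ RingHom.ker f) := by
  let _ : Algebra (A ⧸ P) L := ((algebraMap κ L).comp (algebraMap (A ⧸ P) κ)).toAlgebra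
  have : IsScalarTower (A ⧸ P) κ L := .of_algebraMap_eq fun _ ↦ rfl
  have : Algebra.IsAlgebraic (A ⧸ P) L := (IsFractionRing.comap_isAlgebraic_iff (K := κ)).2 hκ
  let g : (B ⧸ RingHom.ker f) →ₐ[A ⧸ P] L :=
    { RingHom.kerLift f with
      commutes' := fun a ↦ by
        obtain ⟨a, rfl⟩ := Ideal.Quotient.mk_surjective a
        exact h a }
  exact Algebra.IsAlgebraic.of_injective g (RingHom.kerLift_injective _)

/-- Over a prime in the range of a finite type map there is one that is maximal in its fibre; its
residue ring is algebraic over that of the given prime. -/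
theorem exists_prime_isAlgebraic [Algebra.FiniteType A B] (P : PrimeSpectrum A)
    (hP : P ∈ range (PrimeSpectrum.comap (algebraMap A B))) :
    ∃ q : PrimeSpectrum B, ∃ _ : q.asIdeal.LiesOver P.asIdeal,
      Algebra.IsAlgebraic (A ⧸ P.asIdeal) (B ⧸ q.asIdeal) := by
  have : Nontrivial (P.asIdeal.Fiber B) := P.nontrivial_iff_mem_rangeComap.2 hP
  obtain ⟨m, hm⟩ := Ideal.exists_maximal (P.asIdeal.Fiber B)
  let _ : Field (P.asIdeal.Fiber B ⧸ m) := Ideal.Quotient.field m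
  -- Zariski's lemma: a field of finite type over the residue field is finite over it.
  have : Module.Finite P.asIdeal.ResidueField (P.asIdeal.Fiber B ⧸ m) :=
    finite_of_finite_type_of_isJacobsonRing _ _
  let g : B →ₐ[A] P.asIdeal.Fiber B ⧸ m :=
    (Ideal.Quotient.mkₐ A m).comp Algebra.TensorProduct.includeRight
  let f : B →+* P.asIdeal.Fiber B ⧸ m := g
  have hf : RingHom.ker f = m.comap Algebra.TensorProduct.includeRight :=
    Ideal.ext fun b ↦ Ideal.Quotient.eq_zero_iff_mem
  have hq : (RingHom.ker f).IsPrime := RingHom.ker_isPrime f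
  have hover : (RingHom.ker f).LiesOver P.asIdeal := ⟨by
    rw [hf]
    refine (Ideal.over_def m P.asIdeal).trans ?_
    exact Ideal.ext fun a ↦ by simp [Ideal.under, Ideal.mem_comap]⟩
  exact ⟨⟨RingHom.ker f, hq⟩, hover, isAlgebraic_quotient_ker P.asIdeal P.asIdeal.ResidueField _ f
    (Algebra.IsAlgebraic.of_finite _ _) fun a ↦ g.commutes a⟩

theorem isEmbedding_comap_away_quotient (P : Ideal A) (a : A) (R' : Type*) [CommRing R']
    [Algebra (A ⧸ P) R'] [IsLocalization.Away (Ideal.Quotient.mk P a) R'] :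
    IsEmbedding (PrimeSpectrum.comap ((algebraMap (A ⧸ P) R').comp (Ideal.Quotient.mk P))) := by
  rw [PrimeSpectrum.comap_comp]
  exact (PrimeSpectrum.isClosedEmbedding_comap_of_surjective _ _
    Ideal.Quotient.mk_surjective).isEmbedding.comp
    (PrimeSpectrum.localization_comap_isEmbedding R'
      (Submonoid.powers (Ideal.Quotient.mk P a)))

theorem range_comap_away_quotient (P : Ideal A) (a : A) (R' : Type*) [CommRing R']
    [Algebra (A ⧸ P) R'] [IsLocalization.Away (Ideal.Quotient.mk P a) R'] :
    range (PrimeSpectrum.comap ((algebraMap (A ⧸ P) R').comp (Ideal.Quotient.mk P))) =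
      PrimeSpectrum.zeroLocus P ∩ PrimeSpectrum.basicOpen a := by
  rw [PrimeSpectrum.comap_comp, range_comp,
    PrimeSpectrum.localization_away_comap_range R' (Ideal.Quotient.mk P a)]
  have h := range_comap_of_surjective _ (Ideal.Quotient.mk P)
    Ideal.Quotient.mk_surjective
  rw [Ideal.mk_ker] at h
  rw [← h, inter_comm, ← image_preimage_eq_inter_range]
  rfl

/-- Generic finiteness of a finite type map of affine schemes with irreducible source, along some
closed subset of the source with the same image. -/
theorem exists_isClosed_comap_image_eq [Algebra.FiniteType A B]
    [IrreducibleSpace (PrimeSpectrum B)] :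
    ∃ U C : Set (PrimeSpectrum B), IsOpen U ∧ U.Nonempty ∧ IsClosed C ∧
      PrimeSpectrum.comap (algebraMap A B) '' (C ∩ U) = PrimeSpectrum.comap (algebraMap A B) '' U ∧
      IsLocallyClosed (PrimeSpectrum.comap (algebraMap A B) '' U) ∧
      (U ⊆ C → topologicalKrullDim U =
        topologicalKrullDim (PrimeSpectrum.comap (algebraMap A B) '' U)) := by
  have hn : (nilradical B).IsPrime := PrimeSpectrum.irreducibleSpace_iff_isPrime_nilradical.1 inferInstance
  -- `P` is the image of the generic point of `Spec B`.
  obtain ⟨P, hP⟩ : ∃ P, P = PrimeSpectrum.comap (algebraMap A B) ⟨nilradical B, hn⟩ := ⟨_, rfl⟩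
  obtain ⟨q, hq, halg⟩ := exists_prime_isAlgebraic P ⟨_, hP.symm⟩
  obtain ⟨a, ha, hint⟩ := exists_isIntegral_pow_smul (A ⧸ P.asIdeal) (B ⧸ q.asIdeal)
  obtain ⟨a, rfl⟩ := Ideal.Quotient.mk_surjective a
  let f := PrimeSpectrum.comap (algebraMap A B)
  let R' := Localization.Away (Ideal.Quotient.mk P.asIdeal a)
  let S' := Localization.Away (Ideal.Quotient.mk q.asIdeal (algebraMap A B a))
  let ψ := Algebra.ofId (A ⧸ P.asIdeal) (B ⧸ q.asIdeal)
  have hψ : IsLocalization.Away (ψ (Ideal.Quotient.mk P.asIdeal a)) S' := inferInstanceAs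
    (IsLocalization.Away (Ideal.Quotient.mk q.asIdeal (algebraMap A B a)) S')
  have : IsLocalization.Away (algebraMap (A ⧸ P.asIdeal) (B ⧸ q.asIdeal)
    (Ideal.Quotient.mk P.asIdeal a)) S' := hψ
  let φ : R' →ₐ[A ⧸ P.asIdeal] S' :=
    IsLocalization.Away.mapₐ R' S' ψ (Ideal.Quotient.mk P.asIdeal a)
  let _ : Algebra R' S' := φ.toRingHom.toAlgebra
  have : IsScalarTower (A ⧸ P.asIdeal) R' S' := .of_algebraMap_eq fun x ↦ (φ.commutes x).symm
  have : Algebra.IsIntegral R' S' := isIntegral_away hint R' S'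
  have hinj : Function.Injective (algebraMap R' S') :=
    IsLocalization.Away.mapₐ_injective_of_injective (Aₚ := R') (Bₚ := S') (f := ψ)
      (Ideal.Quotient.mk P.asIdeal a)
      (FaithfulSMul.algebraMap_injective (A ⧸ P.asIdeal) (B ⧸ q.asIdeal))
  let g := PrimeSpectrum.comap (algebraMap R' S')
  let iA := PrimeSpectrum.comap ((algebraMap (A ⧸ P.asIdeal) R').comp (Ideal.Quotient.mk P.asIdeal))
  let iB := PrimeSpectrum.comap ((algebraMap (B ⧸ q.asIdeal) S').comp (Ideal.Quotient.mk q.asIdeal))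
  have hiA : IsEmbedding iA := isEmbedding_comap_away_quotient _ a R'
  have hiB : IsEmbedding iB := isEmbedding_comap_away_quotient _ (algebraMap A B a) S'
  have hrA : range iA = _ := range_comap_away_quotient _ a R'
  have hrB : range iB = _ := range_comap_away_quotient _ (algebraMap A B a) S'
  have hsq : f ∘ iB = iA ∘ g := by
    funext x
    refine PrimeSpectrum.ext (Ideal.ext fun b ↦ ?_)
    change algebraMap (B ⧸ q.asIdeal) S' (algebraMap (A ⧸ P.asIdeal) (B ⧸ q.asIdeal)
      (Ideal.Quotient.mk P.asIdeal b)) ∈ x.asIdeal ↔ algebraMap R' S'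
      (algebraMap (A ⧸ P.asIdeal) R' (Ideal.Quotient.mk P.asIdeal b)) ∈ x.asIdeal
    rw [← IsScalarTower.algebraMap_apply (A ⧸ P.asIdeal) (B ⧸ q.asIdeal) S',
      ← IsScalarTower.algebraMap_apply (A ⧸ P.asIdeal) R' S']
  have hg : Function.Surjective g := comap_surjective_of_isIntegral R' S' hinj
  let U : Set (PrimeSpectrum B) := PrimeSpectrum.basicOpen (algebraMap A B a)
  let C : Set (PrimeSpectrum B) := PrimeSpectrum.zeroLocus q.asIdeal
  -- `C ∩ U` is `Spec S'`, which maps onto `Spec R'` by integrality and injectivity.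
  have hCU : f '' (C ∩ U) = range iA := by
    rw [← hrB, ← range_comp, hsq, hg.range_comp]
  have hU : f '' U = range iA := by
    -- Each prime of `B` contains the nilradical, so its contraction contains `P`: no point of `U`
    -- maps outside `Spec R'`.
    refine Subset.antisymm ?_ (hCU ▸ image_mono inter_subset_right)
    rintro _ ⟨x, hx, rfl⟩
    rw [hrA]
    refine ⟨?_, hx⟩
    rw [PrimeSpectrum.mem_zeroLocus, hP]
    exact Ideal.comap_mono (nilradical_le_prime x.asIdeal)
  refine ⟨U, C, PrimeSpectrum.isOpen_basicOpen, ?_, PrimeSpectrum.isClosed_zeroLocus _,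
    hCU.trans hU.symm, ?_, fun hUC ↦ ?_⟩
  -- The generic point lies in `U` because `a ∉ P`.
  · refine ⟨⟨nilradical B, hn⟩, fun h ↦ ha ?_⟩
    rw [Ideal.Quotient.eq_zero_iff_mem, hP]
    exact h
  · change IsLocallyClosed (f '' U)
    rw [hU, hrA, inter_comm]
    exact ⟨_, _, PrimeSpectrum.isOpen_basicOpen, PrimeSpectrum.isClosed_zeroLocus _, rfl⟩
  · change _ = topologicalKrullDim (f '' U)
    rw [hU, ← hiA.toHomeomorph.isHomeomorph.topologicalKrullDim_eq]
    have : U = range iB := by rw [hrB, inter_eq_right.2 hUC]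
    rw [this, ← hiB.toHomeomorph.isHomeomorph.topologicalKrullDim_eq]
    rw [PrimeSpectrum.topologicalKrullDim_eq_ringKrullDim, PrimeSpectrum.topologicalKrullDim_eq_ringKrullDim]
    exact ringKrullDim_eq_of_isIntegral R' S' hinj

end Affine

/-! ### The slice for schemes -/

section Scheme

theorem exists_isClosed_specMap_image_eq {A B : CommRingCat.{u}} (φ : A ⟶ B)
    (hφ : φ.hom.FiniteType) [hB : IrreducibleSpace (Spec B)] :
    ∃ U C : Set (Spec B), IsOpen U ∧ U.Nonempty ∧ IsClosed C ∧
      Spec.map φ '' (C ∩ U) = Spec.map φ '' U ∧ IsLocallyClosed (Spec.map φ '' U) ∧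
      (U ⊆ C → topologicalKrullDim U = topologicalKrullDim (Spec.map φ '' U)) := by
  let _ : Algebra A B := φ.hom.toAlgebra
  have : Algebra.FiniteType A B := hφ
  have : IrreducibleSpace (PrimeSpectrum B) := hB
  exact exists_isClosed_comap_image_eq (A := A) (B := B)

/-- Generic finiteness of a morphism of schemes locally of finite type, along some closed subset
of an irreducible open subset of the source with the same image. -/
theorem exists_isClosed_image_eq {X Y : Scheme.{u}} (f : X ⟶ Y) [LocallyOfFiniteType f]
    [NoetherianSpace X] [Nonempty X] :
    ∃ U C : Set X, IsOpen U ∧ IsIrreducible U ∧ IsClosed C ∧ f '' (C ∩ U) = f '' U ∧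
      IsLocallyClosed (f '' U) ∧
      (U ⊆ C → topologicalKrullDim U = topologicalKrullDim (f '' U)) := by
  obtain ⟨D, hD⟩ : (irreducibleComponents X).Nonempty :=
    ⟨_, irreducibleComponent_mem_irreducibleComponents (Classical.arbitrary X)⟩
  -- There are finitely many components, so one contains a nonempty open set; affine opens inside it
  -- are irreducible.
  obtain ⟨O, hO, ⟨x, hxO⟩, hOD⟩ :=
    NoetherianSpace.exists_isOpen_nonempty_subset_irreducibleComponent D hD
  obtain ⟨V, hV, hxV, -⟩ := exists_isAffineOpen_mem_and_subset (TopologicalSpace.Opens.mem_top (f x))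
  obtain ⟨W, hW, hxW, hWsub⟩ := exists_isAffineOpen_mem_and_subset
    (U := (⟨O, hO⟩ : X.Opens) ⊓ f ⁻¹ᵁ V) ⟨hxO, hxV⟩
  have hWV : W ≤ f ⁻¹ᵁ V := fun _ h ↦ (hWsub h).2
  have hWD : (W : Set X) ⊆ D := fun _ h ↦ hOD (hWsub h).1
  have hjW : IsOpenEmbedding hW.fromSpec := hW.fromSpec.isOpenEmbedding
  have hjV : IsOpenEmbedding hV.fromSpec := hV.fromSpec.isOpenEmbedding
  have hWi : IsIrreducible (W : Set X) :=
    ⟨⟨x, hxW⟩, (hD.1.isPreirreducible).open_subset W.isOpen hWD⟩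
  have hrange : range hW.fromSpec = W := hW.range_fromSpec
  have : IrreducibleSpace (Spec Γ(X, W)) := by
    rw [irreducibleSpace_def]
    have h : hW.fromSpec ⁻¹' W = univ := by rw [← hrange, preimage_range]
    have := hWi.isPreirreducible.preimage hjW
    rw [h] at this
    obtain ⟨y, -⟩ : x ∈ range hW.fromSpec := hrange ▸ hxW
    exact ⟨⟨y, trivial⟩, this⟩
  obtain ⟨U, C, hU, hUne, hC, hCU, hlc, hdim⟩ :=
    exists_isClosed_specMap_image_eq (f.appLE V W hWV) (f.finiteType_appLE hV hW hWV)
  have hsq (S : Set (Spec Γ(X, W))) : f '' (hW.fromSpec '' S) = hV.fromSpec '' (Spec.map (f.appLE V W hWV) '' S) := by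
    have := IsAffineOpen.SpecMap_appLE_fromSpec f hV hW hWV
    rw [image_image, image_image]
    refine image_congr fun s _ ↦ ?_
    rw [← Scheme.Hom.comp_apply, ← this, Scheme.Hom.comp_apply]
  have hinter : closure (hW.fromSpec '' C) ∩ hW.fromSpec '' U = hW.fromSpec '' (C ∩ U) := by
    have : hW.fromSpec ⁻¹' closure (hW.fromSpec '' C) = C := by
      rw [← hjW.isInducing.closure_eq_preimage_closure_image, hC.closure_eq]
    rw [inter_comm, ← image_inter_preimage, this, inter_comm]
  refine ⟨hW.fromSpec '' U, closure (hW.fromSpec '' C), hjW.isOpenMap _ hU,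
    ⟨hUne.image _, hWi.isPreirreducible.open_subset (hjW.isOpenMap _ hU)
      ((image_subset_range _ _).trans hrange.le)⟩, isClosed_closure, ?_, ?_, fun hUC ↦ ?_⟩
  · rw [hinter, hsq, hsq, hCU]
  · rw [hsq]
    exact hlc.image hjV.isInducing hjV.isOpen_range.isLocallyClosed
  · rw [hsq, ← (hjV.isEmbedding.homeomorphImage _).isHomeomorph.topologicalKrullDim_eq,
      ← (hjW.isEmbedding.homeomorphImage _).isHomeomorph.topologicalKrullDim_eq]
    refine hdim ?_
    rw [← inter_eq_right, hinter] at hUC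
    rw [← inter_eq_right]
    exact hjW.injective.image_injective hUC

end Scheme

/-! ### Points over an algebraically closed field -/

section Points

variable {K : Type u} [Field K]

theorem toPoint_mapPoints {X Y : GroupScheme K} (f : X ⟶ Y) (p : Points X) :
    (mapPoints f p).toPoint = f.hom.hom.left p.toPoint := by
  simp only [Points.toPoint, mapPoints, Over.comp_left]
  exact Scheme.Hom.comp_apply _ _ _

/-- The homeomorphism of spaces of points induced by an isomorphism of schemes over `K`. -/
noncomputable def pointsHomeomorph {X : GroupScheme K} (α : X.X ≅ X.X) :
    letI := zariski X
    Points X ≃ₜ Points X :=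
  letI := zariski X
  { toFun := fun p ↦ p ≫ α.hom
    invFun := fun p ↦ p ≫ α.inv
    left_inv := fun p ↦ by simp
    right_inv := fun p ↦ by simp
    continuous_toFun := continuous_points α.hom
    continuous_invFun := continuous_points α.inv }

open scoped MonObj in
theorem comp_mulRight_hom {X : GroupScheme K} (p q : Points X) :
    p ≫ (GrpObj.mulRight q).hom = p * q := by
  simp [Hom.mul_def, CartesianMonoidalCategory.comp_lift_assoc]

open scoped MonObj in
theorem mapPoints_mul {X Y : GroupScheme K} (f : X ⟶ Y) (p q : Points X) :
    mapPoints f (p * q) = mapPoints f p * mapPoints f q :=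
  MonObj.mul_comp p q f.hom.hom

variable [IsAlgClosed K]

theorem toPoint_injective (X : GroupScheme K) [LocallyOfFiniteType X.X.hom] :
    Function.Injective (Points.toPoint (X := X)) := fun p q h ↦
  Over.OverMorphism.ext (ext_of_apply_closedPoint_eq X.X.hom (Over.w p) (Over.w q) h)

theorem isClosed_toPoint (X : GroupScheme K) [LocallyOfFiniteType X.X.hom] (p : Points X) :
    IsClosed {p.toPoint} :=
  (pointEquivClosedPoint X.X.hom ⟨p.left, Over.w p⟩).2

theorem exists_toPoint_eq (X : GroupScheme K) [LocallyOfFiniteType X.X.hom] {x : X.X.left}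
    (hx : IsClosed {x}) : ∃ p : Points X, p.toPoint = x :=
  ⟨Over.homMk (pointOfClosedPoint X.X.hom x hx) (pointOfClosedPoint_comp X.X.hom x hx),
    pointOfClosedPoint_apply X.X.hom x hx _⟩

/-- The `K`-points are the closed points, and a scheme locally of finite type over a field is
Jacobson. -/
theorem isVeryDense_toPoint (X : GroupScheme K) [LocallyOfFiniteType X.X.hom] :
    @IsVeryDense _ _ (zariski X) _ (Points.toPoint (X := X)) := by
  let _ := zariski X
  refine ⟨⟨rfl⟩, fun W hW hne ↦ ?_⟩
  have : JacobsonSpace X.X.left := LocallyOfFiniteType.jacobsonSpace (Y := Spec _) X.X.hom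
  obtain ⟨x, hxW, hx⟩ := nonempty_inter_closedPoints hne hW
  obtain ⟨p, rfl⟩ := exists_toPoint_eq X hx
  exact ⟨p, hxW⟩

/-- The fibre over a `K`-point is closed, so where it meets `W` it does so in a locally closed set,
which contains a `K`-point. -/
theorem mapPoints_image_preimage {X Y : GroupScheme K} [LocallyOfFiniteType X.X.hom]
    [LocallyOfFiniteType Y.X.hom] (f : X ⟶ Y) {W : Set X.X.left} (hW : IsLocallyClosed W) :
    mapPoints f '' (Points.toPoint ⁻¹' W) = Points.toPoint ⁻¹' (f.hom.hom.left '' W) := by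
  refine Subset.antisymm ?_ ?_
  · rintro _ ⟨p, hp, rfl⟩
    exact ⟨_, hp, (toPoint_mapPoints f p).symm⟩
  · rintro q ⟨x, hx, hxq⟩
    let _ := zariski X
    have hcl : IsClosed (f.hom.hom.left ⁻¹' {q.toPoint}) :=
      (isClosed_toPoint Y q).preimage f.hom.hom.left.continuous
    obtain ⟨p, hpW, hpq⟩ := (isVeryDense_toPoint X).exists_mem (hW.inter hcl.isLocallyClosed)
      ⟨x, hx, hxq⟩
    exact ⟨p, hpW, toPoint_injective Y ((toPoint_mapPoints f p).trans hpq)⟩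

open scoped MonObj in
theorem krullDim_range_mapPoints {X Y : GroupScheme K} (hX : LocallyOfFiniteType X.X.hom)
    (hX' : QuasiCompact X.X.hom) (hY : LocallyOfFiniteType Y.X.hom) (f : X ⟶ Y)
    (h : ∀ H : Set (Points X), IsClosed[zariski X] H → mapPoints f '' H = range (mapPoints f) →
      H = univ) :
    krullDimOf (zariski Y) (range (mapPoints f)) = krullDimOf (zariski X) univ := by
  let _ := zariski X
  let _ := zariski Y
  have hlft : LocallyOfFiniteType f.hom.hom.left := by
    have : LocallyOfFiniteType (f.hom.hom.left ≫ Y.X.hom) := by rwa [Over.w]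
    exact locallyOfFiniteType_of_comp _ Y.X.hom
  have : IsLocallyNoetherian X.X.left :=
    LocallyOfFiniteType.isLocallyNoetherian (Y := Spec (.of K)) X.X.hom
  have : CompactSpace X.X.left := QuasiCompact.compactSpace_of_compactSpace X.X.hom
  have : IsNoetherian X.X.left := {}
  have : Nonempty X.X.left := ⟨(neutral X).toPoint⟩
  have hvX := isVeryDense_toPoint X
  have hvY := isVeryDense_toPoint Y
  have : NoetherianSpace (Points X) := hvX.isInducing.noetherianSpace
  obtain ⟨U, C, hU, hUi, hC, hCU, hlc, hdim⟩ := exists_isClosed_image_eq f.hom.hom.left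
  have hUimg := mapPoints_image_preimage f hU.isLocallyClosed
  have key := topologicalKrullDim_range_eq (φ := mapPoints f)
    (U := Points.toPoint ⁻¹' U) (C := Points.toPoint ⁻¹' C) ?_
    (hU.preimage hvX.isInducing.continuous)
    (hvX.isIrreducible_preimage hU.isLocallyClosed hUi) ?_ ?_
    (hC.preimage hvX.isInducing.continuous) ?_ h
  · refine key.trans ?_
    exact (Homeomorph.Set.univ (Points X)).symm.isHomeomorph.topologicalKrullDim_eq
  · intro x y
    -- Right translation by `x⁻¹ * y` takes `x` to `y`, and `f` intertwines it with translation by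
    -- the image of that element.
    refine ⟨pointsHomeomorph (GrpObj.mulRight (x⁻¹ * y)),
      pointsHomeomorph (GrpObj.mulRight (mapPoints f (x⁻¹ * y))), ?_, fun p ↦ ?_⟩
    · exact (comp_mulRight_hom _ _).trans (mul_inv_cancel_left x y)
    · refine (congrArg (mapPoints f) (comp_mulRight_hom _ _)).trans ?_
      exact (mapPoints_mul f _ _).trans (comp_mulRight_hom _ _).symm
  · rw [← preimage_inter, mapPoints_image_preimage f (hC.isLocallyClosed.inter hU.isLocallyClosed),
      hCU, hUimg]
  · rw [hUimg]
    exact hlc.preimage hvY.isInducing.continuous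
  · intro hUC
    rw [hUimg, hvY.topologicalKrullDim_preimage_eq hlc,
      hvX.topologicalKrullDim_preimage_eq hU.isLocallyClosed]
    refine hdim ?_
    by_contra hne
    obtain ⟨x, hxU, hxC⟩ := Set.not_subset.1 hne
    obtain ⟨p, hpU, hpC⟩ := hvX.exists_mem
      (hU.isLocallyClosed.inter hC.isOpen_compl.isLocallyClosed) ⟨x, hxU, hxC⟩
    exact hpC (hUC hpU)

end Points

/-! ### Finite powers inherit finiteness properties -/

section Power

/-- Adding one factor is a fibre product over `S`, whose structure map is a base change followed by
`X.hom`. -/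
theorem exists_power (Q : MorphismProperty Scheme.{u}) [Q.IsMultiplicative]
    [Q.IsStableUnderBaseChange] {S : Scheme.{u}} (X : Over S) (hX : Q X.hom)
    (ι : Type v) [Finite ι] :
    ∃ (T : Over S) (π : ι → (T ⟶ X)), Q T.hom ∧
      ∀ (T' : Over S) (c : ι → (T' ⟶ X)), ∃! m : T' ⟶ T, ∀ i, m ≫ π i = c i := by
  induction ι using Finite.induction_empty_option with
  | of_equiv e ih =>
    obtain ⟨T, π, hT, h⟩ := ih
    refine ⟨T, fun i ↦ π (e.symm i), hT, fun T' c ↦ ?_⟩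
    simpa [e.forall_congr_left] using h T' fun i ↦ c (e i)
  | h_empty =>
    refine ⟨𝟙_ _, fun i ↦ i.elim, Q.id_mem S, fun T' c ↦ ⟨CartesianMonoidalCategory.toUnit _,
      fun i ↦ i.elim, fun _ _ ↦ CartesianMonoidalCategory.toUnit_unique _ _⟩⟩
  | h_option ih =>
    obtain ⟨T, π, hT, h⟩ := ih
    refine ⟨X ⊗ T, fun i ↦ i.elim (CartesianMonoidalCategory.fst X T)
      fun i ↦ CartesianMonoidalCategory.snd X T ≫ π i, ?_, fun T' c ↦ ?_⟩
    · rw [Over.tensorObj_hom]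
      exact Q.comp_mem _ _ (Q.pullback_fst _ _ hT) hX
    · obtain ⟨m, hm, huniq⟩ := h T' fun i ↦ c (some i)
      refine ⟨CartesianMonoidalCategory.lift (c none) m, ?_, fun m' hm' ↦ ?_⟩
      · rintro (_ | i)
        · simp
        · simpa using hm i
      · ext1
        · simpa using hm' none
        · simpa using huniq _ fun i ↦ by simpa using hm' (some i)

variable {K : Type u} [Field K]

/-- `power` is a product of group objects; its underlying object has the same universal property as
the iterated fibre product, hence is isomorphic to it. -/
theorem power_hom_mem (Q : MorphismProperty Scheme.{u}) [Q.IsMultiplicative]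
    [Q.IsStableUnderBaseChange] (X : GroupScheme K) (hX : Q X.X.hom) (ι : Type v) [Finite ι] :
    Q (power X ι).X.hom := by
  obtain ⟨T, π, hT, h⟩ := exists_power Q X.X hX ι
  obtain ⟨m, hm, -⟩ := h _ fun i ↦ powerProj X i
  have h1 : powerLift π ≫ m = 𝟙 T := (h T π).unique
    (fun i ↦ by rw [Category.assoc, hm, powerLift_proj]) fun i ↦ Category.id_comp _
  have h2 : m ≫ powerLift π = 𝟙 _ := power_hom_ext fun i ↦ by
    rw [Category.assoc, powerLift_proj, hm, Category.id_comp]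
  let e : (power X ι).X ≅ T := ⟨m, powerLift π, h2, h1⟩
  have : IsIso e.hom.left := ((Over.forget _).mapIso e).isIso_hom
  rw [← Over.w e.hom]
  exact Q.comp_mem _ _ (Q.of_isIso _) hT

end Power

/-! ### Neutral elements and coordinates of points -/

section Points

variable {K : Type u} [Field K]

theorem mapPoints_neutral {X Y : GroupScheme K} (f : X ⟶ Y) :
    mapPoints f (neutral X) = neutral Y := IsMonHom.one_hom f.hom.hom

theorem mapPoints_comp {X Y Z : GroupScheme K} (f : X ⟶ Y) (g : Y ⟶ Z) (p : Points X) :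
    mapPoints (f ≫ g) p = mapPoints g (mapPoints f p) := (Category.assoc _ _ _).symm

theorem mapPoints_zero {X Y : GroupScheme K} (p : Points X) :
    mapPoints (0 : X ⟶ Y) p = neutral Y := by
  change p ≫ CartesianMonoidalCategory.toUnit _ ≫ MonObj.one = MonObj.one
  rw [← Category.assoc, CartesianMonoidalCategory.toUnit_unique
    (p ≫ CartesianMonoidalCategory.toUnit _) (𝟙 _), Category.id_comp]

theorem pointsPower_apply {X : GroupScheme K} {ι : Type v} [Finite ι] (p : Points (power X ι))
    (i : ι) : pointsPower X ι p i = mapPoints (Pi.π (fun _ : ι ↦ X) i) p := rfl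

theorem pointsPower_symm_neutral (X : GroupScheme K) (ι : Type v) [Finite ι] :
    (pointsPower X ι).symm (fun _ ↦ neutral X) = neutral (power X ι) := by
  rw [Equiv.symm_apply_eq]
  funext i
  exact (mapPoints_neutral (Pi.π (fun _ : ι ↦ X) i)).symm

theorem krullDimOf_zariskiPower (X : GroupScheme K) (ι : Type v) [Finite ι]
    (D : Set (Points (power X ι))) :
    krullDimOf (zariskiPower X ι) (pointsPower X ι '' D) = krullDimOf (zariski (power X ι)) D := by
  let _ := zariski (power X ι)
  let _ := zariskiPower X ι
  let e : Points (power X ι) ≃ₜ (ι → Points X) :=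
    ((pointsPower X ι).symm.toHomeomorphOfIsInducing ⟨rfl⟩).symm
  exact ((e.image D).isHomeomorph.topologicalKrullDim_eq).symm

end Points

/-! ### Cellular automata as homomorphisms of finite powers -/

section CellularAutomata

variable {K : Type u} [Field K] {G : Type v} [Group G] {X : GroupScheme K}

open Classical in
/-- The homomorphism `X^Ω → X^F` induced by a cellular automaton with local defining map `f` on
configurations that are neutral outside `Ω`. -/
noncomputable def inducedHom {M : Finset G} (f : power X M ⟶ X) (Ω F : Finset G) : power X Ω ⟶ power X F :=
  Pi.lift fun g : F ↦ (Pi.lift fun m : M ↦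
    if h : g.1 * m.1 ∈ Ω then Pi.π (fun _ : Ω ↦ X) ⟨g.1 * m.1, h⟩ else 0) ≫ f

theorem pointsPower_mapPoints_inducedHom {τ : (G → Points X) → (G → Points X)} {M : Finset G}
    {f : power X M ⟶ X}
    (hτ : HasLocalMap τ M fun a ↦ mapPoints f ((pointsPower X M).symm a)) (Ω F : Finset G)
    {c : G → Points X} (hc : ∀ g ∉ Ω, c g = neutral X) :
    pointsPower X F (mapPoints (inducedHom f Ω F) ((pointsPower X Ω).symm (restrict Ω c))) =
      restrict F (τ c) := by
  classical
  funext g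
  rw [pointsPower_apply, ← mapPoints_comp, inducedHom, Pi.lift_π, mapPoints_comp]
  change _ = τ c g
  rw [hτ c g]
  congr 1
  rw [Equiv.eq_symm_apply]
  funext m
  rw [pointsPower_apply, ← mapPoints_comp, Pi.lift_π]
  change _ = c ((g.1⁻¹)⁻¹ * m)
  rw [inv_inv]
  split_ifs with h
  · rw [← pointsPower_apply, Equiv.apply_symm_apply]
    rfl
  · rw [mapPoints_zero, hc _ h]

theorem apply_eq_neutral {τ : (G → Points X) → (G → Points X)} {M : Finset G}
    {f : power X M ⟶ X}
    (hτ : HasLocalMap τ M fun a ↦ mapPoints f ((pointsPower X M).symm a)) {Ω : Finset G}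
    {c : G → Points X} (hc : ∀ g ∉ Ω, c g = neutral X) {g : G} (hg : ∀ m ∈ M, g * m ∉ Ω) :
    τ c g = neutral X := by
  have : restrict M (shift g⁻¹ c) = fun _ ↦ neutral X := by
    funext m
    change c ((g⁻¹)⁻¹ * m) = _
    rw [inv_inv, hc _ (hg m m.2)]
  rw [hτ c g, this]
  exact (congrArg (mapPoints f) (pointsPower_symm_neutral X M)).trans (mapPoints_neutral f)

end CellularAutomata

end AlgCA

open AlgCA in
theorem mainTheorem5 {K : Type u} [Field K] [IsAlgClosed K] {G : Type v} [Group G]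
    (X : AlgCA.GroupScheme K) (hX : AlgCA.IsAlgebraicGroup X)
    (τ : (G → AlgCA.Points X) → (G → AlgCA.Points X)) (hτ : τ ∈ AlgCA.CAalgr G X)
    (h : AlgCA.OneDotPreInjective τ) :
    AlgCA.TwoDotPreInjective τ := by
  classical
  obtain ⟨M, f, hτ⟩ := hτ
  intro Ω
  -- `F = Ω M⁻¹` consists of the `g` whose window `g M` meets `Ω`; elsewhere `τ c` is neutral.
  let F : Finset G := Finset.image₂ (fun w m ↦ w * m⁻¹) Ω M
  have hF {c : G → Points X} (hc : ∀ g ∉ Ω, c g = neutral X) : ∀ g ∉ F, τ c g = neutral X :=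
    fun g hg ↦ apply_eq_neutral hτ hc fun m hm hgm ↦
      hg (Finset.mem_image₂.2 ⟨g * m, hgm, m, hm, mul_inv_cancel_right g m⟩)
  have hsub : τ '' extendByNeutral (Ω := Ω) Set.univ ⊆ extendByNeutral (Ω := F) Set.univ := by
    rintro _ ⟨c, hc, rfl⟩
    exact ⟨trivial, hF hc.2⟩
  have hext (p : Points (power X Ω)) : ∃ c : G → Points X, (∀ g ∉ Ω, c g = neutral X) ∧
      restrict Ω c = pointsPower X Ω p :=
    ⟨fun g ↦ if hg : g ∈ Ω then pointsPower X Ω p ⟨g, hg⟩ else neutral X,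
      fun g hg ↦ dif_neg hg, funext fun g ↦ dif_pos g.2⟩
  have himg : restrict F '' (τ '' extendByNeutral (Ω := Ω) Set.univ) =
      pointsPower X F '' Set.range (mapPoints (inducedHom f Ω F)) := by
    refine Set.Subset.antisymm ?_ ?_
    · rintro _ ⟨_, ⟨c, hc, rfl⟩, rfl⟩
      exact ⟨_, ⟨_, rfl⟩, pointsPower_mapPoints_inducedHom hτ Ω F hc.2⟩
    · rintro _ ⟨_, ⟨p, rfl⟩, rfl⟩
      obtain ⟨c, hc, hcp⟩ := hext p
      refine ⟨τ c, ⟨c, ⟨trivial, hc⟩, rfl⟩, ?_⟩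
      rw [← pointsPower_mapPoints_inducedHom hτ Ω F hc, hcp, Equiv.symm_apply_apply]
  rw [krullDimOf_zariskiConfig F _ hsub, himg, krullDimOf_zariskiPower,
    ← Set.image_univ_of_surjective (pointsPower X Ω).surjective, krullDimOf_zariskiPower]
  refine krullDim_range_mapPoints
    (power_hom_mem @LocallyOfFiniteType X hX.locallyOfFiniteType Ω)
    (power_hom_mem @QuasiCompact X hX.quasiCompact Ω)
    (power_hom_mem @LocallyOfFiniteType X hX.locallyOfFiniteType F) _ fun H hH hrange ↦ ?_
  by_contra hne
  -- A proper closed `H` with full image is exactly what `(•)`-pre-injectivity forbids.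
  refine h ⟨Ω, (pointsPower X Ω).symm ⁻¹' H, ?_, ?_, Set.Subset.antisymm ?_ ?_⟩
  · let _ := zariski (power X Ω)
    exact isClosed_induced_iff.2 ⟨H, hH, rfl⟩
  · rw [Set.ssubset_univ_iff]
    intro huniv
    exact hne (Set.preimage_injective.2 (pointsPower X Ω).symm.surjective huniv)
  · rintro _ ⟨c, hc, rfl⟩
    obtain ⟨p, hpH, hp⟩ : mapPoints (inducedHom f Ω F) ((pointsPower X Ω).symm (restrict Ω c)) ∈
      mapPoints (inducedHom f Ω F) '' H := hrange ▸ ⟨_, rfl⟩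
    obtain ⟨d, hd, hdp⟩ := hext p
    refine ⟨d, ⟨?_, hd⟩, funext fun g ↦ ?_⟩
    · rw [Set.mem_preimage, hdp, Equiv.symm_apply_apply]
      exact hpH
    -- The homomorphism determines `τ` only on `F`; outside `F` both images are neutral.
    · by_cases hg : g ∈ F
      · refine congrFun (?_ : restrict F (τ d) = restrict F (τ c)) ⟨g, hg⟩
        rw [← pointsPower_mapPoints_inducedHom hτ Ω F hc.2,
          ← pointsPower_mapPoints_inducedHom hτ Ω F hd, hdp, Equiv.symm_apply_apply, hp]
      · rw [hF hd g hg, hF hc.2 g hg]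
  · exact Set.image_mono fun c hc ↦ ⟨trivial, hc.2⟩
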